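/- Fix an integer $n\ge 1$ and $z\in\mathbb{C}$ with $|z|\neq 1$. For every integer $k\ge 1$ let $C_0=C_0^{(k)},\dots,C_{k-1}=C_{k-1}^{(k)}$ be random $n\times n$ complex matrices, defined on a common probability space, such that all the entries of all these matrices (for all $j$ and all $k$) are i.i.d. circularly symmetric complex Gaussian random variables with mean $0$ and variance $1$ (that is, real and imaginary parts are independent real Gaussians with mean $0$ and variance $1/2$). Let $$M=M_k=\begin{bmatrix} -C_{k-1} & \cdots & -C_1 & -C_0\\ I_n & & & \\ & \ddots & & \\ & & I_n & 0\end{bmatrix}\in\mathbb{C}^{kn\times kn}$$ be the companion matrix of the monic matrix polynomial $I_nx^k+\sum_{j=0}^{k-1}C_jx^j$ (blocks not shown are zero; $M_1=-C_0$), and denote by $\sigma_1(X)\ge\sigma_2(X)\ge\dots\ge\sigma_{kn}(X)\ge 0$ the singular values of $X\in\mathbb{C}^{kn\times kn}$. Then there is a constant $t>0$, depending only on $n$ and $z$, such that, with probability $1$, $$\sigma_{kn}(M_k-zI)\ \ge\ t\,k^{-2}$$ for all sufficiently large $k$ (how large may depend on the outcome). -/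

import Mathlib

open MeasureTheory ProbabilityTheory Filter

/-- The law of a (circularly symmetric) complex Gaussian random variable with mean `0` and
variance `E|X|² = 1`: the real and imaginary parts are independent real Gaussians with mean `0`
and variance `1/2`. -/
noncomputable def stdComplexGaussian : Measure ℂ :=
  ((gaussianReal 0 (1 / 2)).prod (gaussianReal 0 (1 / 2))).map Complex.measurableEquivRealProd.symm

/-- The block companion matrix of the monic matrix polynomial
`I xᵏ + C (k-1) x^(k-1) + ⋯ + C 1 x + C 0`. Its first block row is
`[-C (k-1), …, -C 1, -C 0]`, it has identity blocks just below the block diagonal, and zero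
blocks elsewhere. The index `(i, a)` is the `a`-th position inside the `i`-th block. -/
def companionMatrix {k n : ℕ} (C : Fin k → Matrix (Fin n) (Fin n) ℂ) :
    Matrix (Fin k × Fin n) (Fin k × Fin n) ℂ :=
  Matrix.of fun p q =>
    if (p.1 : ℕ) = 0 then -(C (Fin.rev q.1) p.2 q.2)
    else if (p.1 : ℕ) = (q.1 : ℕ) + 1 then (1 : Matrix (Fin n) (Fin n) ℂ) p.2 q.2
    else 0

/-- `singularValue A i` is the `i`-th largest singular value `σᵢ(A)` of a complex matrix, counted
with multiplicity and starting from `i = 1` (Mathlib's sequence starts from `0`). -/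
noncomputable def singularValue {ι κ : Type*} [Fintype ι] [DecidableEq ι] [Fintype κ]
    [DecidableEq κ] (A : Matrix ι κ ℂ) (i : ℕ) : ℝ :=
  (Matrix.toEuclideanLin A).singularValues (i - 1)

/-! It suffices to bound `‖v‖` by a multiple of `k ^ 2 * ‖w‖`, where `w = (M - z) v`. All block rows
but the first say `v (p - 1) = z * v p + w p`. As `‖z‖ ≠ 1`, this recurrence is stable, uniformly in
`k`, from one end `e`: the last block if `‖z‖ < 1`, the first if `‖z‖ > 1`
(`exists_recurrence_stable`). So `v` is the homogeneous solution `α p • x`, with `x = v e`, plus an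
error of size `O(‖w‖)`.

Substituting into the first block row gives `G x = O(F * ‖w‖)`, where `F ≥ 1` bounds the Frobenius
norm of the coefficients and `G` is the `n × n` matrix `z α₀ I + ∑ α_j C_{k-1-j}`
(`norm_le_of_columnSeparated_affineMatrix`). Since `α e = 1`, one Gaussian matrix enters `G` with
coefficient `1`, so each column of `G` is `δ`-separated from the others outside an event of
probability at most `4 δ²` (`pi_not_columnSeparated_le`). Markov's inequality controls `F`. With `δ
= k^(-3/4)` and `F = k^(5/4)` the bad events have probability `O(k^(-3/2))`, Borel–Cantelli applies,
and the loss is `F / δ = k²`. -/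

/-! ### Small balls and second moment of the Gaussian law -/

/-- The density is at most `1 / √π < 1`. -/
lemma gaussianReal_half_le_volume (s : Set ℝ) : gaussianReal 0 (1 / 2) s ≤ volume s := by
  rw [gaussianReal_apply _ (by norm_num)]
  calc ∫⁻ x in s, gaussianPDF 0 (1 / 2) x ≤ ∫⁻ _ in s, 1 := by
        refine lintegral_mono fun x => ?_
        rw [gaussianPDF, ← ENNReal.ofReal_one]
        refine ENNReal.ofReal_le_ofReal ?_
        rw [gaussianPDFReal]
        refine mul_le_one₀ ?_ (Real.exp_nonneg _) ?_
        · refine inv_le_one_of_one_le₀ (Real.one_le_sqrt.2 ?_)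
          have := Real.pi_gt_three
          push_cast
          linarith
        · refine Real.exp_le_one_iff.2 ?_
          rw [neg_div]
          exact neg_nonpos.2 (by positivity)
    _ = volume s := by simp

instance : IsProbabilityMeasure stdComplexGaussian :=
  Measure.isProbabilityMeasure_map (by fun_prop)

lemma stdComplexGaussian_ball_le (c : ℂ) (δ : ℝ) :
    stdComplexGaussian (Metric.ball c δ) ≤ ENNReal.ofReal (4 * δ ^ 2) := by
  rcases le_or_gt δ 0 with hδ | hδ
  · simp [Metric.ball_eq_empty.2 hδ]
  rw [stdComplexGaussian, MeasurableEquiv.map_apply]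
  calc _ ≤ ((gaussianReal 0 (1 / 2)).prod (gaussianReal 0 (1 / 2)))
        (Metric.ball c.re δ ×ˢ Metric.ball c.im δ) := by
        refine measure_mono fun p hp => ?_
        rw [Set.mem_preimage, mem_ball_iff_norm] at hp
        constructor
        · rw [mem_ball_iff_norm]
          exact (Complex.abs_re_le_norm _).trans_lt hp
        · rw [mem_ball_iff_norm]
          exact (Complex.abs_im_le_norm _).trans_lt hp
    _ ≤ ENNReal.ofReal (2 * δ) * ENNReal.ofReal (2 * δ) := by
        rw [Measure.prod_prod]
        gcongr
        · exact (gaussianReal_half_le_volume _).trans (by simp)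
        · exact (gaussianReal_half_le_volume _).trans (by simp)
    _ = ENNReal.ofReal (4 * δ ^ 2) := by
        rw [← ENNReal.ofReal_mul (by positivity)]
        ring_nf

lemma lintegral_sq_stdComplexGaussian_lt_top :
    ∫⁻ x, ENNReal.ofReal (‖x‖ ^ 2) ∂stdComplexGaussian < ⊤ := by
  have h : Integrable (fun x : ℝ => x ^ 2) (gaussianReal 0 (1 / 2)) :=
    (memLp_id_gaussianReal 2).integrable_sq
  have h2 : Integrable (fun p : ℝ × ℝ => p.1 ^ 2 + p.2 ^ 2)
      ((gaussianReal 0 (1 / 2)).prod (gaussianReal 0 (1 / 2))) :=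
    (h.comp_fst _).add (h.comp_snd _)
  rw [stdComplexGaussian, lintegral_map_equiv]
  refine lt_of_eq_of_lt (lintegral_congr fun p => ?_) h2.lintegral_lt_top
  rw [Complex.sq_norm, Complex.normSq_apply, pow_two, pow_two]
  rfl

/-! ### Bounding product measures by partial integration -/

section Marginal

variable {κ : Type*} [DecidableEq κ] {X : κ → Type*} [∀ i, MeasurableSpace (X i)]
  {μ : ∀ i, Measure (X i)} [∀ i, IsProbabilityMeasure (μ i)]

lemma lmarginal_const_prob (s : Finset κ) (c : ENNReal) :
    ∫⋯∫⁻_s, (fun _ => c) ∂μ = fun _ => c := by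
  ext x
  simp [lmarginal]

lemma lmarginal_le_of_update {s : Finset κ} {i : κ} (hi : i ∈ s) {f : (∀ i, X i) → ENNReal}
    (hf : Measurable f) {c : ENNReal}
    (h : ∀ y, ∫⁻ t, f (Function.update y i t) ∂μ i ≤ c) (x : ∀ i, X i) :
    (∫⋯∫⁻_s, f ∂μ) x ≤ c := by
  rw [lmarginal_erase' _ hf hi]
  calc _ ≤ (∫⋯∫⁻_(s.erase i), (fun _ => c) ∂μ) x := lmarginal_mono (fun y => h y) x
    _ = c := by rw [lmarginal_const_prob]

lemma pi_le_of_lmarginal_le [Fintype κ] {s : Finset κ} {S : Set (∀ i, X i)} (hS : MeasurableSet S)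
    {c : ENNReal} (h : ∀ x, (∫⋯∫⁻_s, S.indicator 1 ∂μ) x ≤ c) : Measure.pi μ S ≤ c := by
  have hle := lintegral_le_of_lmarginal_le (μ := μ) s (f := S.indicator 1) (g := fun _ => c)
    (measurable_one.indicator hS) measurable_const
    (fun x => by rw [lmarginal_const_prob]; exact h x)
  rw [lintegral_indicator_one hS] at hle
  simpa using hle

end Marginal

/-! ### Singular values from lower norm bounds -/

section SingularValue

variable {E F : Type*} [NormedAddCommGroup E] [InnerProductSpace ℂ E] [FiniteDimensional ℂ E]
  [NormedAddCommGroup F] [InnerProductSpace ℂ F] [FiniteDimensional ℂ F]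

/-- An eigenvector `v` of `T* T` for `σᵢ²` satisfies `‖T v‖ = σᵢ ‖v‖`. -/
lemma le_singularValues_of_forall_le_norm (T : E →ₗ[ℂ] F) {c : ℝ}
    (h : ∀ v, c * ‖v‖ ≤ ‖T v‖) {i : ℕ} (hi : i < Module.finrank ℂ E) :
    c ≤ T.singularValues i := by
  obtain ⟨v, hv⟩ := (T.hasEigenvalue_adjoint_comp_self_sq_singularValues hi).exists_hasEigenvector
  have hv0 : 0 < ‖v‖ := norm_pos_iff.2 hv.2
  have h1 : ((‖T v‖ ^ 2 : ℝ) : ℂ) = ((T.singularValues i ^ 2 * ‖v‖ ^ 2 : ℝ) : ℂ) := by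
    have h2 : inner ℂ v ((LinearMap.adjoint T ∘ₗ T) v) = inner ℂ (T v) (T v) := by
      simp [LinearMap.adjoint_inner_right]
    rw [hv.apply_eq_smul, inner_smul_right, inner_self_eq_norm_sq_to_K,
      inner_self_eq_norm_sq_to_K] at h2
    push_cast
    simpa using h2.symm
  have h3 : ‖T v‖ ^ 2 = T.singularValues i ^ 2 * ‖v‖ ^ 2 := by exact_mod_cast h1
  have h4 : ‖T v‖ = T.singularValues i * ‖v‖ := by
    rw [← mul_pow] at h3
    exact (pow_left_inj₀ (norm_nonneg _) (mul_nonneg (T.singularValues_nonneg i) hv0.le)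
      two_ne_zero).1 h3
  exact le_of_mul_le_mul_right ((h v).trans h4.le) hv0

end SingularValue

lemma le_singularValue_of_forall_le_norm {ι : Type*} [Fintype ι] [DecidableEq ι]
    (A : Matrix ι ι ℂ) {c : ℝ}
    (h : ∀ v : ι → ℂ, c * ‖WithLp.toLp 2 v‖ ≤ ‖WithLp.toLp 2 (A.mulVec v)‖) {i : ℕ}
    (hi : i ≤ Fintype.card ι) (hi0 : 0 < i) : c ≤ singularValue A i := by
  refine le_singularValues_of_forall_le_norm _ (fun v => ?_) (by simp; omega)
  simpa [Matrix.toLpLin_apply] using h v.ofLp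

/-! ### Quantitative invertibility by column separation -/

section ColumnSeparation

variable {ι : Type*} [Fintype ι]

/-- The `i`-th column of `A` has distance at least `δ` (up to a dimensional constant) from the span
of the other columns, witnessed by a linear functional `u`. -/
def ColumnSeparated (A : Matrix ι ι ℂ) (δ : ℝ) (i : ι) : Prop :=
  ∃ u : ι → ℂ, ‖u‖ = 1 ∧ (∀ j, j ≠ i → Matrix.vecMul u A j = 0) ∧ δ ≤ ‖Matrix.vecMul u A i‖

/-- Projection along the compact unit sphere of functionals is a closed map. This supplies
measurability later. -/
lemma isClosed_setOf_columnSeparated (δ : ℝ) (i : ι) :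
    IsClosed {A : Matrix ι ι ℂ | ColumnSeparated A δ i} := by
  have hcl : IsClosed {p : Matrix ι ι ℂ × Metric.sphere (0 : ι → ℂ) 1 |
      (∀ j, j ≠ i → Matrix.vecMul p.2.1 p.1 j = 0) ∧ δ ≤ ‖Matrix.vecMul p.2.1 p.1 i‖} := by
    have hc : ∀ j, Continuous fun p : Matrix ι ι ℂ × Metric.sphere (0 : ι → ℂ) 1 =>
        Matrix.vecMul p.2.1 p.1 j := fun j =>
      (continuous_apply j).comp
        (Continuous.matrix_vecMul (continuous_subtype_val.comp continuous_snd) continuous_fst)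
    simp only [Set.ofPred_and, Set.ofPred_forall]
    refine IsClosed.inter ?_ (isClosed_le continuous_const (hc i).norm)
    exact isClosed_iInter fun j => isClosed_iInter fun _ => isClosed_eq (hc j) continuous_const
  convert isClosedMap_fst_of_compactSpace _ hcl using 1
  ext A
  constructor
  · rintro ⟨u, hu, h⟩
    exact ⟨(A, ⟨u, by simp [hu]⟩), h, rfl⟩
  · rintro ⟨⟨B, u⟩, h, rfl⟩
    exact ⟨u.1, by simp, h⟩

/-- Pairing `A x` with the witness `u` kills every coordinate of `x` except `x i`. -/
lemma ColumnSeparated.norm_le {A : Matrix ι ι ℂ} {δ : ℝ} {i : ι} (h : ColumnSeparated A δ i)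
    (x : ι → ℂ) : δ * ‖x i‖ ≤ ∑ a, ‖A.mulVec x a‖ := by
  classical
  obtain ⟨u, hu, hu0, hui⟩ := h
  have h1 : dotProduct u (A.mulVec x) = Matrix.vecMul u A i * x i := by
    rw [Matrix.dotProduct_mulVec, dotProduct, Finset.sum_eq_single i]
    · intro j _ hj
      rw [hu0 j hj, zero_mul]
    · simp
  calc δ * ‖x i‖ ≤ ‖Matrix.vecMul u A i‖ * ‖x i‖ := by gcongr
    _ = ‖dotProduct u (A.mulVec x)‖ := by rw [h1, norm_mul]
    _ ≤ ∑ a, ‖u a * A.mulVec x a‖ := norm_sum_le _ _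
    _ ≤ ∑ a, ‖A.mulVec x a‖ := by
        refine Finset.sum_le_sum fun a _ => ?_
        rw [norm_mul]
        exact mul_le_of_le_one_left (norm_nonneg _) (hu ▸ norm_le_pi_norm u a)

lemma norm_toLp_le_sum (x : ι → ℂ) : ‖WithLp.toLp 2 x‖ ≤ ∑ a, ‖x a‖ := by
  classical
  have h : WithLp.toLp 2 x = ∑ a, EuclideanSpace.single a (x a) := by
    ext b
    simp [Finset.sum_apply]
  rw [h]
  exact (norm_sum_le _ _).trans (by simp)

lemma sum_norm_le_card_mul (x : ι → ℂ) :
    ∑ a, ‖x a‖ ≤ Fintype.card ι * ‖WithLp.toLp 2 x‖ := by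
  calc ∑ a, ‖x a‖ ≤ ∑ _a : ι, ‖WithLp.toLp 2 x‖ :=
        Finset.sum_le_sum fun a _ => PiLp.norm_apply_le (WithLp.toLp 2 x) a
    _ = _ := by simp

lemma norm_le_of_columnSeparated {A : Matrix ι ι ℂ} {δ : ℝ} (hδ : 0 ≤ δ)
    (h : ∀ i, ColumnSeparated A δ i) (x : ι → ℂ) :
    δ * ‖WithLp.toLp 2 x‖ ≤ Fintype.card ι ^ 2 * ‖WithLp.toLp 2 (A.mulVec x)‖ := by
  calc δ * ‖WithLp.toLp 2 x‖ ≤ δ * ∑ i, ‖x i‖ := by gcongr; exact norm_toLp_le_sum x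
    _ = ∑ i, δ * ‖x i‖ := Finset.mul_sum _ _ _
    _ ≤ ∑ _i : ι, Fintype.card ι * ‖WithLp.toLp 2 (A.mulVec x)‖ :=
        Finset.sum_le_sum fun i _ => ((h i).norm_le x).trans (sum_norm_le_card_mul _)
    _ = _ := by simp; ring

lemma exists_norm_eq_one_vecMul_eq_zero [DecidableEq ι] (A : Matrix ι ι ℂ) (i : ι) :
    ∃ u : ι → ℂ, ‖u‖ = 1 ∧ ∀ j, j ≠ i → Matrix.vecMul u A j = 0 := by
  obtain ⟨v, hv, hvA⟩ := Matrix.exists_vecMul_eq_zero_iff.2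
    (Matrix.det_eq_zero_of_column_eq_zero (A := A.updateCol i 0) i (by simp))
  refine ⟨((‖v‖⁻¹ : ℝ) : ℂ) • v, by simp [norm_smul, hv], fun j hj => ?_⟩
  have h := congrFun hvA j
  simp only [Matrix.vecMul, dotProduct, Matrix.updateCol_ne hj, Pi.zero_apply] at h
  simp only [Pi.smul_apply, Matrix.vecMul, dotProduct, smul_mul_assoc, ← Finset.smul_sum, h,
    smul_zero]

end ColumnSeparation

/-! ### Column separation for random affine combinations -/

section AffineMatrix

variable {κ ι : Type*} [Fintype κ]

/-- The matrix `D + ∑ q, β q • W q`, where `w` lists the entries of the matrices `W q`. -/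
def affineMatrix (D : Matrix ι ι ℂ) (β : κ → ℂ) (w : κ × ι × ι → ℂ) : Matrix ι ι ℂ :=
  Matrix.of fun a b => D a b + ∑ q, β q * w (q, a, b)

lemma continuous_affineMatrix (D : Matrix ι ι ℂ) (β : κ → ℂ) :
    Continuous (affineMatrix D β) := by
  refine continuous_matrix fun a b => ?_
  simp only [affineMatrix, Matrix.of_apply]
  fun_prop

variable [Fintype ι]

lemma measurableSet_not_columnSeparated (D : Matrix ι ι ℂ) (β : κ → ℂ) (δ : ℝ) (i : ι) :
    MeasurableSet {w | ¬ ColumnSeparated (affineMatrix D β w) δ i} :=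
  ((isClosed_setOf_columnSeparated δ i).preimage
    (continuous_affineMatrix D β)).measurableSet.compl

variable [DecidableEq κ] [DecidableEq ι]

lemma lintegral_update_affineMatrix_le (D : Matrix ι ι ℂ) {β : κ → ℂ} {q : κ}
    (hq : β q = 1) {u : ι → ℂ} {a i : ι} (ha : ‖u a‖ = 1) (δ : ℝ) (w : κ × ι × ι → ℂ) :
    ∫⁻ t, Set.indicator {w | ‖Matrix.vecMul u (affineMatrix D β w) i‖ < δ} 1
      (Function.update w (q, a, i) t) ∂stdComplexGaussian ≤ ENNReal.ofReal (4 * δ ^ 2) := by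
  have hu : u a ≠ 0 := norm_ne_zero_iff.1 (by simp [ha])
  have haff : ∀ t, Matrix.vecMul u (affineMatrix D β (Function.update w (q, a, i) t)) i =
      u a * (t - w (q, a, i)) + Matrix.vecMul u (affineMatrix D β w) i := by
    intro t
    have h1 : ∀ b, affineMatrix D β (Function.update w (q, a, i) t) b i =
        affineMatrix D β w b i + if b = a then t - w (q, a, i) else 0 := by
      intro b
      simp only [affineMatrix, Matrix.of_apply, add_assoc, add_right_inj]
      have h2 : ∀ r, β r * Function.update w (q, a, i) t (r, b, i) =
          β r * w (r, b, i) + if r = q then (if b = a then t - w (q, a, i) else 0) else 0 := by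
        intro r
        by_cases hr : r = q
        · by_cases hb : b = a
          · subst hr hb
            simp [hq]
          · simp [hb]
        · simp [hr]
      simp [h2, Finset.sum_add_distrib]
    simp only [Matrix.vecMul, dotProduct, h1, mul_add, Finset.sum_add_distrib]
    simp [add_comm]
  -- The value of the resampled entry at which the functional vanishes.
  set c : ℂ := w (q, a, i) - (u a)⁻¹ * Matrix.vecMul u (affineMatrix D β w) i with hc
  calc _ = ∫⁻ t, (Metric.ball c δ).indicator 1 t ∂stdComplexGaussian := by
        refine lintegral_congr fun t => ?_
        simp only [Set.indicator, Set.mem_ofPred_eq, Pi.one_apply, mem_ball_iff_norm, haff]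
        have : u a * (t - w (q, a, i)) + Matrix.vecMul u (affineMatrix D β w) i =
            u a * (t - c) := by
          rw [hc]
          field_simp
          ring
        rw [this, norm_mul, ha, one_mul]
    _ ≤ _ := by
        rw [lintegral_indicator_one Metric.isOpen_ball.measurableSet]
        exact stdComplexGaussian_ball_le c δ

/-- Freeze all columns but the `i`-th. A unit functional `u` annihilating them is then fixed, and
failure of separation forces its value on column `i` into a small ball. -/
lemma pi_not_columnSeparated_le (D : Matrix ι ι ℂ) {β : κ → ℂ} {q : κ} (hq : β q = 1) (δ : ℝ)
    (i : ι) :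
    Measure.pi (fun _ : κ × ι × ι => stdComplexGaussian)
      {w | ¬ ColumnSeparated (affineMatrix D β w) δ i} ≤ ENNReal.ofReal (4 * δ ^ 2) := by
  refine pi_le_of_lmarginal_le (s := Finset.univ.filter fun s => s.2.2 = i)
    (measurableSet_not_columnSeparated D β δ i) fun w => ?_
  obtain ⟨u, hu, hu0⟩ := exists_norm_eq_one_vecMul_eq_zero (affineMatrix D β w) i
  -- The norm is the sup norm, so it is attained at an entry.
  obtain ⟨a, ha⟩ : ∃ a, ‖u a‖ = 1 := by
    have : Nonempty ι := ⟨i⟩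
    obtain ⟨a, ha⟩ := (IsGreatest.pi_norm u).1
    exact ⟨a, ha.trans hu⟩
  have hmeas : MeasurableSet {w | ‖Matrix.vecMul u (affineMatrix D β w) i‖ < δ} := by
    refine (isOpen_lt (Continuous.norm ?_) continuous_const).measurableSet
    exact (continuous_apply i).comp
      (Continuous.matrix_vecMul continuous_const (continuous_affineMatrix D β))
  calc _ ≤ (∫⋯∫⁻_(Finset.univ.filter fun s => s.2.2 = i),
        (Set.indicator {w | ‖Matrix.vecMul u (affineMatrix D β w) i‖ < δ} 1)
        ∂(fun _ => stdComplexGaussian)) w := by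
        refine lintegral_mono fun y => ?_
        set w' := Function.updateFinset w (Finset.univ.filter fun s => s.2.2 = i) y with hw'
        by_cases hmem : w' ∈ {w | ¬ ColumnSeparated (affineMatrix D β w) δ i}
        · have hlt : ‖Matrix.vecMul u (affineMatrix D β w') i‖ < δ := by
            by_contra! hle
            refine hmem ⟨u, hu, fun j hj => ?_, hle⟩
            rw [← hu0 j hj]
            have h1 : ∀ r b, w' (r, b, j) = w (r, b, j) := fun r b => by
              simp [hw', Function.updateFinset, hj]
            simp only [Matrix.vecMul, dotProduct, affineMatrix, Matrix.of_apply, h1]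
          rw [Set.indicator_of_mem hmem, Set.indicator_of_mem (by exact hlt)]
        · rw [Set.indicator_of_notMem hmem]
          exact zero_le
    _ ≤ _ := lmarginal_le_of_update (i := (q, a, i)) (by simp)
        (measurable_one.indicator hmeas) (fun w => lintegral_update_affineMatrix_le D hq ha δ w) w

end AffineMatrix

/-! ### Euclidean norms of block vectors -/

section EuclideanNorm

variable {ι κ : Type*} [Fintype ι] [Fintype κ]

lemma norm_toLp_comp_le (v : κ → ℂ) {f : ι → κ} (hf : Function.Injective f) :
    ‖WithLp.toLp 2 (v ∘ f)‖ ≤ ‖WithLp.toLp 2 v‖ := by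
  classical
  rw [EuclideanSpace.norm_eq, EuclideanSpace.norm_eq]
  refine Real.sqrt_le_sqrt ?_
  calc ∑ i, ‖v (f i)‖ ^ 2 = ∑ j ∈ Finset.univ.image f, ‖v j‖ ^ 2 := by
        rw [Finset.sum_image fun _ _ _ _ h => hf h]
    _ ≤ ∑ j, ‖v j‖ ^ 2 :=
        Finset.sum_le_sum_of_subset_of_nonneg (Finset.subset_univ _) fun _ _ _ => by positivity

lemma norm_sum_mul_le (f g : ι → ℂ) :
    ‖∑ i, f i * g i‖ ≤ ‖WithLp.toLp 2 f‖ * ‖WithLp.toLp 2 g‖ := by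
  rw [EuclideanSpace.norm_eq, EuclideanSpace.norm_eq]
  refine (norm_sum_le _ _).trans ?_
  simp only [norm_mul]
  exact Real.sum_mul_le_sqrt_mul_sqrt _ _ _

lemma le_add_of_sq_eq_add_sq {a b c : ℝ} (hb : 0 ≤ b) (hc : 0 ≤ c) (h : a ^ 2 = b ^ 2 + c ^ 2) :
    a ≤ b + c :=
  le_of_sq_le_sq (by nlinarith [mul_nonneg hb hc]) (by positivity)

variable {m : ℕ}

lemma norm_toLp_le_castSucc_add_last (v : Fin (m + 1) × ι → ℂ) :
    ‖WithLp.toLp 2 v‖ ≤ ‖WithLp.toLp 2 (v ∘ Prod.map Fin.castSucc id)‖ +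
      ‖WithLp.toLp 2 fun a => v (Fin.last m, a)‖ := by
  refine le_add_of_sq_eq_add_sq (norm_nonneg _) (norm_nonneg _) ?_
  simp only [EuclideanSpace.norm_sq_eq, Fintype.sum_prod_type, Fin.sum_univ_castSucc]
  rfl

lemma norm_toLp_le_succ_add_zero (v : Fin (m + 1) × ι → ℂ) :
    ‖WithLp.toLp 2 v‖ ≤ ‖WithLp.toLp 2 (v ∘ Prod.map Fin.succ id)‖ +
      ‖WithLp.toLp 2 fun a => v (0, a)‖ := by
  refine le_add_of_sq_eq_add_sq (norm_nonneg _) (norm_nonneg _) ?_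
  simp only [EuclideanSpace.norm_sq_eq, Fintype.sum_prod_type, Fin.sum_univ_succ, add_comm]
  rfl

end EuclideanNorm

/-! ### Stability of the block recurrence -/

section Recurrence

variable {ι : Type*} [Fintype ι] {m : ℕ}

/-- Blocks other than the last have total norm at most `‖z‖ ‖v‖ + ‖w‖`; the first term is absorbed
on the left, so no constant depends on `m`. -/
lemma norm_le_of_recurrence_of_norm_lt_one {z : ℂ} {v w : Fin (m + 1) × ι → ℂ}
    (h : ∀ p a, v (Fin.castSucc p, a) = z * v (Fin.succ p, a) + w (Fin.succ p, a)) :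
    (1 - ‖z‖) * ‖WithLp.toLp 2 v‖ ≤
      ‖WithLp.toLp 2 w‖ + ‖WithLp.toLp 2 fun a => v (Fin.last m, a)‖ := by
  have hinj : Function.Injective (Prod.map Fin.succ id : Fin m × ι → Fin (m + 1) × ι) :=
    (Fin.succ_injective m).prodMap Function.injective_id
  have h1 : WithLp.toLp 2 (v ∘ Prod.map Fin.castSucc id) =
      z • WithLp.toLp 2 (v ∘ Prod.map Fin.succ id) +
        WithLp.toLp 2 (w ∘ Prod.map Fin.succ id) := by
    ext ⟨p, a⟩
    simpa using h p a
  have h2 : ‖WithLp.toLp 2 (v ∘ Prod.map Fin.castSucc id)‖ ≤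
      ‖z‖ * ‖WithLp.toLp 2 v‖ + ‖WithLp.toLp 2 w‖ := by
    rw [h1]
    refine (norm_add_le _ _).trans (add_le_add ?_ (norm_toLp_comp_le w hinj))
    rw [norm_smul]
    exact mul_le_mul_of_nonneg_left (norm_toLp_comp_le v hinj) (norm_nonneg _)
  linarith [norm_toLp_le_castSucc_add_last v]

lemma norm_le_of_recurrence_of_one_lt_norm {z : ℂ} {v w : Fin (m + 1) × ι → ℂ}
    (h : ∀ p a, v (Fin.castSucc p, a) = z * v (Fin.succ p, a) + w (Fin.succ p, a)) :
    (‖z‖ - 1) * ‖WithLp.toLp 2 v‖ ≤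
      ‖WithLp.toLp 2 w‖ + ‖z‖ * ‖WithLp.toLp 2 fun a => v (0, a)‖ := by
  have h1 : z • WithLp.toLp 2 (v ∘ Prod.map Fin.succ id) =
      WithLp.toLp 2 (v ∘ Prod.map Fin.castSucc id) -
        WithLp.toLp 2 (w ∘ Prod.map Fin.succ id) := by
    ext ⟨p, a⟩
    simp [h p a]
  have h2 : ‖z‖ * ‖WithLp.toLp 2 (v ∘ Prod.map Fin.succ id)‖ ≤
      ‖WithLp.toLp 2 v‖ + ‖WithLp.toLp 2 w‖ := by
    rw [← norm_smul, h1]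
    exact (norm_sub_le _ _).trans (add_le_add
      (norm_toLp_comp_le v ((Fin.castSucc_injective m).prodMap Function.injective_id))
      (norm_toLp_comp_le w ((Fin.succ_injective m).prodMap Function.injective_id)))
  nlinarith [mul_le_mul_of_nonneg_left (norm_toLp_le_succ_add_zero v) (norm_nonneg z)]

/-- The recurrence `v (p - 1) = z * v p + w p` with `‖z‖ ≠ 1` is stable from one of the two ends
of the index range (the end `e`), where its homogeneous version has the solution `α`. -/
lemma exists_recurrence_stable {z : ℂ} (hz : ‖z‖ ≠ 1) :
    ∃ c : ℝ, 0 < c ∧ ∀ m : ℕ, ∃ (e : Fin (m + 1)) (α : Fin (m + 1) → ℂ), α e = 1 ∧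
      (∀ p : Fin m, α p.castSucc = z * α p.succ) ∧
      ∀ (n : ℕ) (v w : Fin (m + 1) × Fin n → ℂ),
        (∀ p a, v (Fin.castSucc p, a) = z * v (Fin.succ p, a) + w (Fin.succ p, a)) →
        ‖WithLp.toLp 2 v‖ ≤
          c * (‖WithLp.toLp 2 w‖ + ‖WithLp.toLp 2 fun a => v (e, a)‖) := by
  rcases lt_or_gt_of_ne hz with hz | hz
  · have hz' : 0 < 1 - ‖z‖ := by linarith
    refine ⟨(1 - ‖z‖)⁻¹, by positivity, fun m => ⟨Fin.last m, fun q => z ^ (m - q : ℕ), by simp,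
      fun p => ?_, fun n v w h => ?_⟩⟩
    · have h : m - (p : ℕ) = m - (p + 1 : ℕ) + 1 := by omega
      simp only [Fin.val_castSucc, Fin.val_succ]
      rw [h, pow_succ']
    · rw [le_inv_mul_iff₀ hz']
      exact norm_le_of_recurrence_of_norm_lt_one h
  · have hz' : 0 < ‖z‖ - 1 := by linarith
    have hz0 : z ≠ 0 := norm_pos_iff.1 (by linarith)
    refine ⟨(‖z‖ - 1)⁻¹ * ‖z‖, by positivity, fun m => ⟨0, fun q => (z⁻¹) ^ (q : ℕ), by simp,
      fun p => ?_, fun n v w h => ?_⟩⟩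
    · simp only [Fin.val_castSucc, Fin.val_succ, pow_succ]
      field_simp
    · rw [mul_assoc, le_inv_mul_iff₀ hz']
      refine (norm_le_of_recurrence_of_one_lt_norm h).trans ?_
      rw [mul_add]
      gcongr
      exact le_mul_of_one_le_left (norm_nonneg _) hz.le

end Recurrence

/-! ### Reduction of the companion matrix to an `n × n` matrix -/

section Companion

variable {m n : ℕ}

lemma companionMatrix_sub_mulVec_succ (C : Fin (m + 1) → Matrix (Fin n) (Fin n) ℂ) (z : ℂ)
    (v : Fin (m + 1) × Fin n → ℂ) (p : Fin m) (a : Fin n) :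
    (companionMatrix C - z • (1 : Matrix (Fin (m + 1) × Fin n) (Fin (m + 1) × Fin n) ℂ)).mulVec v
      (p.succ, a) = v (p.castSucc, a) - z * v (p.succ, a) := by
  rw [Matrix.sub_mulVec, Matrix.smul_mulVec, Matrix.one_mulVec, Pi.sub_apply, Pi.smul_apply,
    smul_eq_mul]
  congr 1
  simp only [Matrix.mulVec, dotProduct, Fintype.sum_prod_type, companionMatrix, Matrix.of_apply]
  rw [Finset.sum_eq_single p.castSucc, Finset.sum_eq_single a]
  · simp
  · intro b _ hb
    simp [Matrix.one_apply_ne hb.symm]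
  · simp
  · intro q _ hq
    have : (p : ℕ) ≠ q := fun h => hq (Fin.ext h.symm)
    simp [this]
  · simp

lemma companionMatrix_sub_mulVec_zero (C : Fin (m + 1) → Matrix (Fin n) (Fin n) ℂ) (z : ℂ)
    (v : Fin (m + 1) × Fin n → ℂ) (a : Fin n) :
    (companionMatrix C - z • (1 : Matrix (Fin (m + 1) × Fin n) (Fin (m + 1) × Fin n) ℂ)).mulVec v
      (0, a) = -(∑ s : Fin (m + 1) × Fin n, C s.1.rev a s.2 * v s) - z * v (0, a) := by
  rw [Matrix.sub_mulVec, Matrix.smul_mulVec, Matrix.one_mulVec, Pi.sub_apply, Pi.smul_apply,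
    smul_eq_mul]
  congr 1
  simp [Matrix.mulVec, dotProduct, companionMatrix]

/-- A quantitative invertibility criterion for a shifted block companion matrix: it suffices to
control the coefficients and one `n × n` affine combination of them. -/
lemma norm_le_of_columnSeparated_affineMatrix {z : ℂ} {c : ℝ} (hc : 0 < c) {e : Fin (m + 1)}
    {α : Fin (m + 1) → ℂ} (hαe : α e = 1) (hα : ∀ p : Fin m, α p.castSucc = z * α p.succ)
    (hstable : ∀ v w : Fin (m + 1) × Fin n → ℂ,
      (∀ p a, v (Fin.castSucc p, a) = z * v (Fin.succ p, a) + w (Fin.succ p, a)) →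
      ‖WithLp.toLp 2 v‖ ≤ c * (‖WithLp.toLp 2 w‖ + ‖WithLp.toLp 2 fun a => v (e, a)‖))
    (C : Fin (m + 1) → Matrix (Fin n) (Fin n) ℂ) {F δ : ℝ} (hδ : 0 < δ)
    (hF : ‖WithLp.toLp 2 fun s : Fin (m + 1) × Fin n × Fin n => C s.1 s.2.1 s.2.2‖ ≤ F)
    (hsep : ∀ i, ColumnSeparated (affineMatrix ((z * α 0) • 1) (fun j => α j.rev)
      fun s : Fin (m + 1) × Fin n × Fin n => C s.1 s.2.1 s.2.2) δ i)
    (v : Fin (m + 1) × Fin n → ℂ) :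
    δ * ‖WithLp.toLp 2 v‖ ≤ c * (δ + n ^ 3 * ((F + ‖z‖) * c + 1)) *
      ‖WithLp.toLp 2 ((companionMatrix C -
        z • (1 : Matrix (Fin (m + 1) × Fin n) (Fin (m + 1) × Fin n) ℂ)).mulVec v)‖ := by
  set w := (companionMatrix C -
    z • (1 : Matrix (Fin (m + 1) × Fin n) (Fin (m + 1) × Fin n) ℂ)).mulVec v with hw
  set G := affineMatrix ((z * α 0) • 1) (fun j => α j.rev)
      fun s : Fin (m + 1) × Fin n × Fin n => C s.1 s.2.1 s.2.2 with hG
  have hF0 : 0 ≤ F := (norm_nonneg _).trans hF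
  have hvw : ∀ p a, v (Fin.castSucc p, a) = z * v (Fin.succ p, a) + w (Fin.succ p, a) := by
    intro p a
    rw [hw, companionMatrix_sub_mulVec_succ]
    ring
  set x : Fin n → ℂ := fun a => v (e, a) with hx
  -- Removing the homogeneous solution leaves a solution of the same recurrence vanishing at block
  -- `e`, so stability bounds it by `w` alone.
  set u : Fin (m + 1) × Fin n → ℂ := fun s => v s - α s.1 * x s.2 with hu
  have hu_le : ‖WithLp.toLp 2 u‖ ≤ c * ‖WithLp.toLp 2 w‖ := by
    have h0 : (fun a => u (e, a)) = 0 := by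
      ext a
      simp [hu, hx, hαe]
    have h1 := hstable u w fun p a => by
      simp only [hu, hvw p a, hα p]
      ring
    simpa [h0] using h1
  -- The first block row with `v = u + α x`: the terms in `x` assemble into `-G x`.
  have hGx : ∀ a, G.mulVec x a =
      -(∑ s : Fin (m + 1) × Fin n, C s.1.rev a s.2 * u s) - z * u (0, a) - w (0, a) := by
    intro a
    have h1 : G.mulVec x a = z * α 0 * x a +
        ∑ s : Fin (m + 1) × Fin n, C s.1.rev a s.2 * (α s.1 * x s.2) := by
      rw [Fintype.sum_prod_type, ← Equiv.sum_comp Fin.revPerm, Finset.sum_comm]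
      simp only [hG, affineMatrix, Matrix.mulVec, dotProduct, Matrix.of_apply, add_mul,
        Finset.sum_add_distrib, Matrix.smul_apply, Matrix.one_apply, Finset.sum_mul]
      congr 1
      · simp
      · refine Finset.sum_congr rfl fun b _ => Finset.sum_congr rfl fun q _ => ?_
        simp
        ring
    rw [h1, hw, companionMatrix_sub_mulVec_zero]
    simp only [hu, mul_sub, Finset.sum_sub_distrib]
    ring
  have hGx_le : ∀ a, ‖G.mulVec x a‖ ≤ ((F + ‖z‖) * c + 1) * ‖WithLp.toLp 2 w‖ := by
    intro a
    have h1 : ‖∑ s : Fin (m + 1) × Fin n, C s.1.rev a s.2 * u s‖ ≤ F * ‖WithLp.toLp 2 u‖ := by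
      refine (norm_sum_mul_le (fun s : Fin (m + 1) × Fin n => C s.1.rev a s.2) u).trans ?_
      refine mul_le_mul_of_nonneg_right (le_trans ?_ hF) (norm_nonneg _)
      refine norm_toLp_comp_le (fun s : Fin (m + 1) × Fin n × Fin n => C s.1 s.2.1 s.2.2)
        (f := fun s : Fin (m + 1) × Fin n => (s.1.rev, a, s.2)) ?_
      rintro ⟨q, b⟩ ⟨q', b'⟩ h
      simpa using h
    have h2 : ‖u (0, a)‖ ≤ ‖WithLp.toLp 2 u‖ := PiLp.norm_apply_le (WithLp.toLp 2 u) (0, a)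
    have h3 : ‖w (0, a)‖ ≤ ‖WithLp.toLp 2 w‖ := PiLp.norm_apply_le (WithLp.toLp 2 w) (0, a)
    calc ‖G.mulVec x a‖ ≤ F * ‖WithLp.toLp 2 u‖ + ‖z‖ * ‖WithLp.toLp 2 u‖
          + ‖WithLp.toLp 2 w‖ := by
          rw [hGx]
          refine (norm_sub_le _ _).trans (add_le_add ((norm_sub_le _ _).trans ?_) h3)
          rw [norm_neg, norm_mul]
          gcongr
      _ ≤ F * (c * ‖WithLp.toLp 2 w‖) + ‖z‖ * (c * ‖WithLp.toLp 2 w‖)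
          + ‖WithLp.toLp 2 w‖ := by gcongr
      _ = _ := by ring
  have hx_le : δ * ‖WithLp.toLp 2 x‖ ≤
      n ^ 3 * ((F + ‖z‖) * c + 1) * ‖WithLp.toLp 2 w‖ := by
    calc δ * ‖WithLp.toLp 2 x‖ ≤ (n : ℝ) ^ 2 * ‖WithLp.toLp 2 (G.mulVec x)‖ := by
          simpa using norm_le_of_columnSeparated hδ.le hsep x
      _ ≤ (n : ℝ) ^ 2 * ∑ _a : Fin n, ((F + ‖z‖) * c + 1) * ‖WithLp.toLp 2 w‖ := by
          gcongr
          exact (norm_toLp_le_sum _).trans (Finset.sum_le_sum fun a _ => hGx_le a)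
      _ = _ := by simp; ring
  calc δ * ‖WithLp.toLp 2 v‖ ≤ δ * (c * (‖WithLp.toLp 2 w‖ + ‖WithLp.toLp 2 x‖)) := by
        gcongr
        exact hstable v w hvw
    _ = c * (δ * ‖WithLp.toLp 2 w‖ + δ * ‖WithLp.toLp 2 x‖) := by ring
    _ ≤ c * (δ * ‖WithLp.toLp 2 w‖ +
        n ^ 3 * ((F + ‖z‖) * c + 1) * ‖WithLp.toLp 2 w‖) := by gcongr
    _ = _ := by ring

end Companion

/-! ### Probability of the bad events -/

section GaussianEntries

variable {Ω : Type*} [MeasurableSpace Ω] {P : Measure Ω}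

lemma measure_not_columnSeparated_le [IsProbabilityMeasure P] {κ ι : Type*} [Fintype κ]
    [Fintype ι] [DecidableEq κ] [DecidableEq ι] {X : κ × ι × ι → Ω → ℂ} (hX : ∀ s, HasLaw (X s) stdComplexGaussian P)
    (hind : iIndepFun X P) (D : Matrix ι ι ℂ) {β : κ → ℂ} {q : κ} (hq : β q = 1) (δ : ℝ) (i : ι) :
    P {ω | ¬ ColumnSeparated (affineMatrix D β fun s => X s ω) δ i} ≤
      ENNReal.ofReal (4 * δ ^ 2) := by
  have hmap : P.map (fun ω s => X s ω) = Measure.pi fun _ => stdComplexGaussian := by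
    rw [(iIndepFun_iff_map_fun_eq_pi_map fun s => (hX s).aemeasurable).1 hind]
    simp only [(hX _).map_eq]
  have h := pi_not_columnSeparated_le D hq δ i
  rwa [← hmap, Measure.map_apply_of_aemeasurable
    (aemeasurable_pi_lambda _ fun s => (hX s).aemeasurable)
    (measurableSet_not_columnSeparated D β δ i)] at h

lemma measure_lt_norm_le {T : Type*} [Fintype T] {X : T → Ω → ℂ}
    (hX : ∀ s, HasLaw (X s) stdComplexGaussian P) {F : ℝ} (hF : 0 < F) :
    P {ω | F < ‖WithLp.toLp 2 fun s => X s ω‖} ≤ ENNReal.ofReal (Fintype.card T *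
      (∫⁻ x, ENNReal.ofReal (‖x‖ ^ 2) ∂stdComplexGaussian).toReal / F ^ 2) := by
  have hmeas : Measurable fun x : ℂ => ENNReal.ofReal (‖x‖ ^ 2) := by fun_prop
  have hX' : ∀ s, AEMeasurable (fun ω => ENNReal.ofReal (‖X s ω‖ ^ 2)) P := fun s =>
    hmeas.comp_aemeasurable (hX s).aemeasurable
  have hint : ∫⁻ ω, ∑ s, ENNReal.ofReal (‖X s ω‖ ^ 2) ∂P = ENNReal.ofReal (Fintype.card T *
      (∫⁻ x, ENNReal.ofReal (‖x‖ ^ 2) ∂stdComplexGaussian).toReal) := by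
    rw [lintegral_finsetSum' _ fun s _ => hX' s]
    have h1 : ∀ s, ∫⁻ ω, ENNReal.ofReal (‖X s ω‖ ^ 2) ∂P =
        ∫⁻ x, ENNReal.ofReal (‖x‖ ^ 2) ∂stdComplexGaussian := fun s =>
      (hX s).lintegral_comp hmeas.aemeasurable
    rw [Finset.sum_congr rfl fun s _ => h1 s, ENNReal.ofReal_mul (by positivity),
      ENNReal.ofReal_toReal lintegral_sq_stdComplexGaussian_lt_top.ne]
    simp
  have hmarkov := meas_ge_le_lintegral_div
    (Finset.aemeasurable_fun_sum Finset.univ fun s _ => hX' s)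
    (ε := ENNReal.ofReal (F ^ 2)) (by simpa using hF.ne') ENNReal.ofReal_ne_top
  rw [hint, ← ENNReal.ofReal_div_of_pos (by positivity)] at hmarkov
  refine (measure_mono fun ω hω => ?_).trans hmarkov
  rw [Set.mem_ofPred_eq] at hω ⊢
  rw [← ENNReal.ofReal_sum_of_nonneg fun _ _ => by positivity]
  refine ENNReal.ofReal_le_ofReal ?_
  calc F ^ 2 ≤ ‖WithLp.toLp 2 fun s => X s ω‖ ^ 2 := by gcongr
    _ = _ := by rw [EuclideanSpace.norm_sq_eq]

end GaussianEntries

/-! ### Choice of scales and Borel–Cantelli -/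

theorem lemmaA7 (n : ℕ) (hn : 0 < n) (z : ℂ) (hz : ‖z‖ ≠ 1) :
    ∃ t : ℝ, 0 < t ∧
      ∀ (Ω : Type*) [MeasurableSpace Ω] (P : Measure Ω) [IsProbabilityMeasure P]
        (C : (k : ℕ) → Fin k → Ω → Matrix (Fin n) (Fin n) ℂ),
        (∀ (k : ℕ) (j : Fin k) (a b : Fin n),
          HasLaw (fun ω => C k j ω a b) stdComplexGaussian P) →
        iIndepFun (fun (s : (k : ℕ) × (Fin k × Fin n × Fin n)) (ω : Ω) =>
          C s.1 s.2.1 ω s.2.2.1 s.2.2.2) P →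
        ∀ᵐ ω ∂P, ∀ᶠ k : ℕ in atTop,
          t * (k : ℝ) ^ (-2 : ℤ) ≤
            singularValue
              (companionMatrix (fun j => C k j ω) -
                z • (1 : Matrix (Fin k × Fin n) (Fin k × Fin n) ℂ)) (k * n) := by
  obtain ⟨c, hc, hstable⟩ := exists_recurrence_stable hz
  choose e α hαe hα hv using hstable
  set K : ℝ := c * (1 + n ^ 3 * ((1 + ‖z‖) * c + 1)) with hK
  have hK0 : 0 < K := by positivity
  refine ⟨K⁻¹, by positivity, fun Ω _ P _ C hlaw hind => ?_⟩
  -- Here `k = m + 1`. These exponents make both `δ²` and `k / F²` equal to the summable `k^(-3/2)`,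
  -- while `F / δ = k²`.
  set δ : ℕ → ℝ := fun m => ((m + 1 : ℕ) : ℝ) ^ (-(3 / 4) : ℝ) with hδ
  set F : ℕ → ℝ := fun m => ((m + 1 : ℕ) : ℝ) ^ (5 / 4 : ℝ) with hF
  have hk0 : ∀ m : ℕ, (0 : ℝ) < ((m + 1 : ℕ) : ℝ) := fun m => by positivity
  have hδ0 : ∀ m, 0 < δ m := fun m => Real.rpow_pos_of_pos (hk0 m) _
  have hF0 : ∀ m, 0 < F m := fun m => Real.rpow_pos_of_pos (hk0 m) _
  have hFδ : ∀ m, F m = δ m * ((m + 1 : ℕ) : ℝ) ^ 2 := fun m => by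
    rw [hF, hδ, ← Real.rpow_natCast, ← Real.rpow_add (hk0 m)]
    norm_num
  have hF1 : ∀ m, 1 ≤ F m := fun m =>
    Real.one_le_rpow (by simp) (by norm_num)
  have hδ1 : ∀ m, δ m ≤ 1 := fun m =>
    Real.rpow_le_one_of_one_le_of_nonpos (by simp) (by norm_num)
  set X : (m : ℕ) → Fin (m + 1) × Fin n × Fin n → Ω → ℂ :=
    fun m s ω => C (m + 1) s.1 ω s.2.1 s.2.2 with hX
  have hXlaw : ∀ m s, HasLaw (X m s) stdComplexGaussian P := fun m s => hlaw _ _ _ _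
  have hXind : ∀ m, iIndepFun (X m) P := fun m =>
    hind.precomp (g := fun s => ⟨m + 1, s⟩) fun s s' h => by simpa using h
  set sep : ℕ → Fin n → Set Ω := fun m i => {ω | ¬ ColumnSeparated
    (affineMatrix ((z * α m 0) • 1) (fun j => α m j.rev) fun s => X m s ω) (δ m) i} with hsep
  set large : ℕ → Set Ω := fun m => {ω | F m < ‖WithLp.toLp 2 fun s => X m s ω‖} with hlarge
  set M : ℝ := (∫⁻ x, ENNReal.ofReal (‖x‖ ^ 2) ∂stdComplexGaussian).toReal with hM
  have hM0 : 0 ≤ M := ENNReal.toReal_nonneg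
  have hbound : ∀ m, P ((⋃ i, sep m i) ∪ large m) ≤
      ENNReal.ofReal ((4 * n + n ^ 2 * M) * ((m + 1 : ℕ) : ℝ) ^ (-(3 / 2) : ℝ)) := by
    intro m
    have h1 : P (⋃ i, sep m i) ≤ ENNReal.ofReal (n * (4 * δ m ^ 2)) := by
      calc P (⋃ i, sep m i) ≤ ∑ i, P (sep m i) := measure_iUnion_fintype_le _ _
        _ ≤ ∑ _i : Fin n, ENNReal.ofReal (4 * δ m ^ 2) :=
            Finset.sum_le_sum fun i _ => measure_not_columnSeparated_le (hXlaw m) (hXind m) _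
              (q := (e m).rev) (by simp [hαe]) _ i
        _ = _ := by simp [ENNReal.ofReal_mul]
    have h2 : P (large m) ≤ ENNReal.ofReal ((m + 1 : ℕ) * n ^ 2 * M / F m ^ 2) := by
      refine (measure_lt_norm_le (hXlaw m) (hF0 m)).trans_eq ?_
      rw [← hM]
      simp [pow_two]
    have h3 : δ m ^ 2 = ((m + 1 : ℕ) : ℝ) ^ (-(3 / 2) : ℝ) := by
      rw [hδ, ← Real.rpow_natCast, ← Real.rpow_mul (hk0 m).le]
      norm_num
    have h4 : ((m + 1 : ℕ) : ℝ) / F m ^ 2 = ((m + 1 : ℕ) : ℝ) ^ (-(3 / 2) : ℝ) := by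
      rw [hF, ← Real.rpow_natCast, ← Real.rpow_mul (hk0 m).le]
      nth_rewrite 1 [← Real.rpow_one ((m + 1 : ℕ) : ℝ)]
      rw [← Real.rpow_sub (hk0 m)]
      norm_num
    refine (measure_union_le _ _).trans ((add_le_add h1 h2).trans_eq ?_)
    rw [← ENNReal.ofReal_add (by positivity) (by positivity), h3, mul_assoc, mul_div_right_comm,
      h4]
    congr 1
    ring
  have hsum : (∑' m, P ((⋃ i, sep m i) ∪ large m)) ≠ ⊤ := by
    refine ne_top_of_le_ne_top ?_ (ENNReal.tsum_le_tsum hbound)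
    refine Summable.tsum_ofReal_ne_top (Summable.mul_left _ ?_)
    exact (summable_nat_add_iff 1).2 (Real.summable_nat_rpow.2 (by norm_num))
  filter_upwards [ae_eventually_notMem hsum] with ω hω
  filter_upwards [(tendsto_sub_atTop_nat 1).eventually hω, eventually_ge_atTop 1] with k hgood hk
  obtain ⟨m, rfl⟩ : ∃ m, k = m + 1 := ⟨k - 1, by omega⟩
  rw [Nat.add_sub_cancel] at hgood
  have hgood_sep : ∀ i, ω ∉ sep m i := fun i h => hgood (Or.inl (Set.mem_iUnion.2 ⟨i, h⟩))
  have hgood_norm : ω ∉ large m := fun h => hgood (Or.inr h)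
  refine le_singularValue_of_forall_le_norm _ (fun v => ?_) (by simp) (by positivity)
  have hmain := norm_le_of_columnSeparated_affineMatrix hc (hαe m) (hα m) (hv m n)
    (fun j => C (m + 1) j ω) (hδ0 m) (not_lt.1 hgood_norm) (fun i => not_not.1 (hgood_sep i)) v
  set N := ‖WithLp.toLp 2 ((companionMatrix (fun j => C (m + 1) j ω) -
    z • (1 : Matrix (Fin (m + 1) × Fin n) (Fin (m + 1) × Fin n) ℂ)).mulVec v)‖
  -- As `δ ≤ 1 ≤ F`, every term is dominated by its multiple of `F`; this is where `K` comes from.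
  have hcoef : c * (δ m + n ^ 3 * ((F m + ‖z‖) * c + 1)) ≤ F m * K := by
    have h1 : δ m + n ^ 3 * ((F m + ‖z‖) * c + 1) ≤
        F m + n ^ 3 * ((F m + F m * ‖z‖) * c + F m) := by
      gcongr
      · exact (hδ1 m).trans (hF1 m)
      · exact le_mul_of_one_le_left (norm_nonneg _) (hF1 m)
      · exact hF1 m
    calc _ ≤ c * (F m + n ^ 3 * ((F m + F m * ‖z‖) * c + F m)) := by gcongr
      _ = F m * K := by rw [hK]; ring
  have h5 : δ m * ‖WithLp.toLp 2 v‖ ≤ δ m * (((m + 1 : ℕ) : ℝ) ^ 2 * K * N) := by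
    calc _ ≤ F m * K * N := hmain.trans (by gcongr)
      _ = _ := by rw [hFδ]; ring
  have h6 := le_of_mul_le_mul_left h5 (hδ0 m)
  have h7 : K⁻¹ * ((m + 1 : ℕ) : ℝ) ^ (-2 : ℤ) = (((m + 1 : ℕ) : ℝ) ^ 2 * K)⁻¹ := by
    rw [zpow_neg, zpow_ofNat, mul_comm, ← mul_inv]
  rw [h7, inv_mul_le_iff₀ (by positivity)]
  exact h6
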